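/- **Setting.** A problem $P=(X,f,\mathcal O)$ consists of a convex set $X\subseteq\mathbb R^n$, a function $f:\mathbb R^n\to\mathbb R$ that is convex on $X$ and attains its minimum on $X$, and an oracle $\mathcal O$ answering a query $x$ by $\mathcal O(x)$. Let $\mathcal F$ be a class of problems (with answers of a common type, which may depend on $n$). A (deterministic, black-box) base algorithm knows $X$ and chooses $x_{t+1}$ from $x_1,\mathcal O(x_1),\dots,x_t,\mathcal O(x_t)$. A (deterministic) FMAB algorithm with $K\ge1$ arms knows the decision sets $X_1,\dots,X_K$ of a family $P_1,\dots,P_K\in\mathcal F$; in each round $t$ it chooses, from all its past choices and the answers received, an arm $i_t\in\{1,\dots,K\}$ and a point $x_t$, and receives $\mathcal O_{i_t}(x_t)$. All queries are required to be feasible ($x_t\in X$, resp. $x_t\in X_{i_t}$) on all problems (resp. families) from $\mathcal F$. The regret is $R_O(T)=\sum_{t=1}^T\bigl(f_{i_t}(x_t)-f^*\bigr)$ with $f^*=\min_{i}\min_{x\in X_i}f_i(x)$. A function $g(P,t)$ is an *oracle lower bound* of $\mathcal F$ up to the horizon $T$ if for every base algorithm there is a problem $P\in\mathcal F$ such that $f(x_t)-\min_X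 f\ge g(P,t)$ for all $t=1,\dots,T$. Put $\underline g(t)=\inf_{P\in\mathcal F}g(P,t)$ and $G(m)=\sum_{s=1}^m\underline g(s)$. **Theorem.** (A) Let $T\ge 0$ and $K\ge1$, let $g$ be an oracle lower bound of $\mathcal F$ up to the horizon $T$, and let $g(\cdot,s)$ be bounded below on $\mathcal F$ for every $1\le s\le T$. Then for every FMAB algorithm with $K$ arms there is a family $P_1,\dots,P_K\in\mathcal F$ with $$R_O(T)\ \ge\ \inf_{k_i\in\mathbb Z_{\ge0},\ \sum_{i=1}^Kk_i=T}\ \sum_{i=1}^KG(k_i).$$ (B) Let $T,K\ge1$, let $g$ be an oracle lower bound of $\mathcal F$ up to the horizon $T$, and let $c>0$. In each of the following cases the bound on $\underline g(s)$ for all $1\le s\le T$ implies the bound on $G(m)$ for all $1\le m\le T$ and, for every FMAB algorithm with $K$ arms, the existence of a family in $\mathcal F$ with the stated regret: - ($M,R>0$) $\underline g(s)\ge cMR/\sqrt s$ implies $G(m)\ge cMR\sqrt m$ and $R_O(T)\ge cMR\sqrt T$; - ($L,R>0$) $\underline g(s)\ge cLR^2/s^2$ implies $G(m)\ge cLR^2$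 and $R_O(T)\ge cLR^2$; - ($\mu,M>0$) $\underline g(s)\ge cM^2/(\mu s)$ implies $G(m)\ge c\frac{M^2}{\mu}\log m$ and $R_O(T)\ge c\frac{M^2}{\mu}\log T$; - ($0<\mu\le L$, $R>0$, $\kappa=L/\mu$) $\underline g(s)\ge cR^2e^{-s/\sqrt\kappa}$ implies $G(m)\ge ce^{-1}R^2$ and $R_O(T)\ge ce^{-1}R^2$. (C) For the standard classes with a first-order oracle these orders hold unconditionally. For $\mu,L,M\ge0$ consider the problems in $\mathbb R^n$ for which $f:\mathbb R^n\to\mathbb R$ is convex, the oracle returns on $X$ the value $f(x)$ and a subgradient $f'(x)$, and for all $x,y\in X$ $$\tfrac{\mu}{2}\|x-y\|^2\le f(y)-f(x)-\langle f'(x),y-x\rangle\le\tfrac L2\|x-y\|^2+M\|x-y\|.$$ There is a universal constant $c>0$ such that for all $T,K\ge1$ and every FMAB algorithm with $K$ arms there is a family of $K$ problems in the class with - (i) $R_O(T)\ge cMR\sqrt T$ for the class of convex problems that are $M$-Lipschitz on $X$ ($\mu=L=0$, $M>0$) with $\operatorname{diam}X=R>0$, if $n\ge2T$; - (ii) $R_O(T)\ge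 cLR^2$ for the class of convex problems such that $f$ has an $L$-Lipschitz gradient on $\mathbb R^n$ ($\mu=M=0$, $L>0$) with $\operatorname{diam}X=R>0$, if $n\ge1$; - (iii) $R_O(T)\ge c\frac{M^2}{\mu}\log T$ for the class of $\mu$-strongly convex problems that are $M$-Lipschitz on $X$ ($L=0$, $\mu,M>0$), if $n\ge2T$; - (iv) $R_O(T)\ge cLR^2$, which is $\Omega(R^2)$ for fixed $\mu,L$, for the class of $\mu$-strongly convex problems such that $f$ has an $L$-Lipschitz gradient on $\mathbb R^n$ ($M=0$, $0<\mu\le L$) with $\operatorname{diam}X=R>0$, if $n\ge1$. -/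

import Mathlib

namespace FMAB

universe u

/-- `ℝⁿ` with the Euclidean norm. -/
abbrev E (n : ℕ) : Type := EuclideanSpace ℝ (Fin n)

/-- A decision set together with the dimension of the space in which it lies. -/
structure Domain where
  dim : ℕ
  carrier : Set (E dim)

/-- A convex optimization problem `min_{x ∈ X} f x` with an oracle. In dimension `n` the oracle
answers a query by an element of `Ω n`. The problem has a solution, so that the minimum exists. -/
structure Problem (Ω : ℕ → Type u) where
  dom : Domain
  f : E dom.dim → ℝ
  oracle : E dom.dim → Ω dom.dim
  convex_dom : Convex ℝ dom.carrier
  convex_f : ConvexOn ℝ dom.carrier f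
  exists_min : ∃ x ∈ dom.carrier, IsMinOn f dom.carrier x

/-- `min_{x ∈ X} f x` (attained, by `exists_min`). -/
noncomputable def Problem.minVal {Ω : ℕ → Type u} (P : Problem Ω) : ℝ :=
  sInf (P.f '' P.dom.carrier)

/-! ### Algorithms for a single problem -/

/-- A deterministic black-box algorithm: it knows the decision set and maps the past queries and
oracle answers (most recent first) to the next query. -/
def BaseAlg (Ω : ℕ → Type u) : Type u :=
  (D : Domain) → List (E D.dim × Ω D.dim) → E D.dim

namespace BaseAlg

variable {Ω : ℕ → Type u}

/-- Queries and answers of the first `t` steps, most recent first. -/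
def history (A : BaseAlg Ω) (P : Problem Ω) : ℕ → List (E P.dom.dim × Ω P.dom.dim)
  | 0 => []
  | t + 1 => (A P.dom (A.history P t), P.oracle (A P.dom (A.history P t))) :: A.history P t

/-- The query made after `t` completed steps: `A.query P t` is the point `x_{t+1}`. -/
def query (A : BaseAlg Ω) (P : Problem Ω) (t : ℕ) : E P.dom.dim :=
  A P.dom (A.history P t)

/-- On every problem of the class `F` all queries are feasible. -/
def Feasible (A : BaseAlg Ω) (F : Set (Problem Ω)) : Prop :=
  ∀ P ∈ F, ∀ t, A.query P t ∈ P.dom.carrier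

end BaseAlg

/-! ### Algorithms for the functional multi-armed bandit problem -/

/-- One round as the agent sees it: the index of the arm, the decision and the oracle answer. -/
abbrev Observation (Ω : ℕ → Type u) {K : ℕ} (D : Fin K → Domain) : Type u :=
  (i : Fin K) × (E (D i).dim × Ω (D i).dim)

/-- A deterministic FMAB algorithm: it knows the `K` decision sets and maps the past rounds (most
recent first) to an arm `i` and a point of the space of arm `i`. -/
def BanditAlg (Ω : ℕ → Type u) (K : ℕ) : Type u :=
  (D : Fin K → Domain) → List (Observation Ω D) → (i : Fin K) × E (D i).dim

namespace BanditAlg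

variable {Ω : ℕ → Type u} {K : ℕ}

/-- The decision sets of a family of problems. -/
abbrev doms (P : Fin K → Problem Ω) : Fin K → Domain := fun i => (P i).dom

/-- The oracle of the chosen arm is called at the chosen point. -/
def observe (P : Fin K → Problem Ω) (q : (i : Fin K) × E (doms P i).dim) :
    Observation Ω (doms P) :=
  ⟨q.1, (q.2, (P q.1).oracle q.2)⟩

/-- The first `t` rounds, most recent first. -/
def history (A : BanditAlg Ω K) (P : Fin K → Problem Ω) : ℕ → List (Observation Ω (doms P))
  | 0 => []
  | t + 1 => observe P (A (doms P) (A.history P t)) :: A.history P t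

/-- Arm and point chosen after `t` completed rounds, that is, in round `t + 1`. -/
def choice (A : BanditAlg Ω K) (P : Fin K → Problem Ω) (t : ℕ) : (i : Fin K) × E (P i).dom.dim :=
  A (doms P) (A.history P t)

/-- On every family of problems of the class `F` all decisions are feasible. -/
def Feasible (A : BanditAlg Ω K) (F : Set (Problem Ω)) : Prop :=
  ∀ P : Fin K → Problem Ω, (∀ i, P i ∈ F) →
    ∀ t, (A.choice P t).2 ∈ (P (A.choice P t).1).dom.carrier

/-- The cumulative regret `R_O(T) = ∑_{t=1}^T (f_{i_t}(x_t) - f^*)`, where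
`f^* = min_i min_{x ∈ X_i} f_i x`. -/
noncomputable def regret (A : BanditAlg Ω K) (P : Fin K → Problem Ω) (T : ℕ) : ℝ :=
  ∑ t ∈ Finset.range T, ((P (A.choice P t).1).f (A.choice P t).2 - ⨅ i, (P i).minVal)

end BanditAlg

/-- For every FMAB algorithm with `K` arms there is a family of `K` problems of the class `F` on
which its regret after `T` rounds is at least `b`. -/
def RegretAtLeast {Ω : ℕ → Type u} (F : Set (Problem Ω)) (K T : ℕ) (b : ℝ) : Prop :=
  ∀ A : BanditAlg Ω K, A.Feasible F →
    ∃ P : Fin K → Problem Ω, (∀ i, P i ∈ F) ∧ b ≤ A.regret P T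

/-! ### Oracle lower bounds of a class -/

/-- `g(H, t)` is a uniform lower bound of the class `F` up to the horizon `T`: for every algorithm
some problem `P` of the class has `f(x_t) - min f ≥ g(P, t)` for all `t = 1, …, T`. -/
def IsOracleLowerBound {Ω : ℕ → Type u} (F : Set (Problem Ω)) (g : Problem Ω → ℕ → ℝ) (T : ℕ) :
    Prop :=
  ∀ A : BaseAlg Ω, A.Feasible F →
    ∃ P ∈ F, ∀ t < T, g P (t + 1) ≤ P.f (A.query P t) - P.minVal

/-- The class-wide hardness `inf_H g(H, t)`. -/
noncomputable def hardness {Ω : ℕ → Type u} (F : Set (Problem Ω)) (g : Problem Ω → ℕ → ℝ)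
    (t : ℕ) : ℝ :=
  sInf ((fun P => g P t) '' F)

/-- `G(m) = ∑_{s=1}^m inf_H g(H, s)`. -/
noncomputable def cumHardness {Ω : ℕ → Type u} (F : Set (Problem Ω)) (g : Problem Ω → ℕ → ℝ)
    (m : ℕ) : ℝ :=
  ∑ s ∈ Finset.Icc 1 m, hardness F g s

/-! ### The standard classes with a first-order oracle -/

/-- The answers of a first-order oracle: a value and a (sub)gradient. -/
abbrev FirstOrder (n : ℕ) : Type := ℝ × E n

/-- The (sub)gradient `f'(x)` which the oracle returns. -/
def Problem.subgrad (P : Problem FirstOrder) (x : E P.dom.dim) : E P.dom.dim := (P.oracle x).2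

/-- `f : ℝⁿ → ℝ` is convex, the oracle returns its values and subgradients on `X`, and
`μ/2 ‖x - y‖² ≤ f y - f x - ⟨f' x, y - x⟩ ≤ L/2 ‖x - y‖² + M ‖x - y‖` on `X`. -/
structure InClass (μ L M : ℝ) (P : Problem FirstOrder) : Prop where
  convex : ConvexOn ℝ Set.univ P.f
  value : ∀ x ∈ P.dom.carrier, (P.oracle x).1 = P.f x
  isSubgrad : ∀ x ∈ P.dom.carrier, ∀ y, P.f x + inner ℝ (P.subgrad x) (y - x) ≤ P.f y
  lower : ∀ x ∈ P.dom.carrier, ∀ y ∈ P.dom.carrier,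
    μ / 2 * ‖x - y‖ ^ 2 ≤ P.f y - P.f x - inner ℝ (P.subgrad x) (y - x)
  upper : ∀ x ∈ P.dom.carrier, ∀ y ∈ P.dom.carrier,
    P.f y - P.f x - inner ℝ (P.subgrad x) (y - x) ≤ L / 2 * ‖x - y‖ ^ 2 + M * ‖x - y‖

/-- `f` is `M`-Lipschitz on the decision set. -/
def IsLip (M : ℝ) (P : Problem FirstOrder) : Prop :=
  ∀ x ∈ P.dom.carrier, ∀ y ∈ P.dom.carrier, |P.f x - P.f y| ≤ M * ‖x - y‖

/-- `f` is differentiable with `L`-Lipschitz gradient. -/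
def IsSmooth (L : ℝ) (P : Problem FirstOrder) : Prop :=
  Differentiable ℝ P.f ∧ ∀ x y, ‖gradient P.f x - gradient P.f y‖ ≤ L * ‖x - y‖

/-- The decision set has (finite) diameter `R`. -/
def HasDiam (R : ℝ) (P : Problem FirstOrder) : Prop :=
  Bornology.IsBounded P.dom.carrier ∧ Metric.diam P.dom.carrier = R

/-- Convex `M`-Lipschitz problems in `ℝⁿ`, decision set of diameter `R`. -/
def lipschitzClass (n : ℕ) (M R : ℝ) : Set (Problem FirstOrder) :=
  {P | P.dom.dim = n ∧ HasDiam R P ∧ InClass 0 0 M P ∧ IsLip M P}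

/-- Convex `L`-smooth problems in `ℝⁿ`, decision set of diameter `R`. -/
def smoothClass (n : ℕ) (L R : ℝ) : Set (Problem FirstOrder) :=
  {P | P.dom.dim = n ∧ HasDiam R P ∧ InClass 0 L 0 P ∧ IsSmooth L P}

/-- `μ`-strongly convex `M`-Lipschitz problems in `ℝⁿ`. -/
def strongLipschitzClass (n : ℕ) (μ M : ℝ) : Set (Problem FirstOrder) :=
  {P | P.dom.dim = n ∧ InClass μ 0 M P ∧ IsLip M P}

/-- `μ`-strongly convex `L`-smooth problems in `ℝⁿ`, decision set of diameter `R`. -/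
def strongSmoothClass (n : ℕ) (μ L R : ℝ) : Set (Problem FirstOrder) :=
  {P | P.dom.dim = n ∧ HasDiam R P ∧ InClass μ L 0 P ∧ IsSmooth L P}

end FMAB

/-!
A bandit algorithm run on `K` copies of a single problem is a base algorithm, so an oracle lower
bound transfers verbatim: the regret is at least the sum `G(T)` of the hardness. Giving all rounds
to one arm shows that the infimum over all divisions of the rounds is not larger.

For the Lipschitz classes the hard functions are `μ/2 ‖x‖² + max_j ⟪d_j, x⟫` with
`d_j = M u_j + μ ∑_{i < j} w_i u_i`, where the orthonormal vectors `u_0, u_1, …` are chosen one per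
query, orthogonal to all queries made so far. At a point orthogonal to `u_t, u_{t+1}, …` the forms
`d_j` with `j ≥ t` agree, so if ties go to the smallest index the answer involves `u_0, …, u_t`
only, and the vectors chosen later do not change the past. The point `-∑ w_i u_i` shows that the
gap of the query number `t` is at least `δ + μ/2 ∑_{i ≥ t} w_i²` as soon as
`δ + μ ∑_{i ≥ j} w_i² ≤ M w_j` for all `j`. Constant weights (for `μ = 0`) give the order `√T`;
weights proportional to `1 / j` give the order `log T`, since
`∑_t ∑_{i ≥ t} 1 / i² = ∑_i 1 / i`.

For the smooth classes the single function `L/2 ‖x - a‖²` suffices, with `a` far from the first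
query.
-/

namespace FMAB

open scoped RealInnerProductSpace

section Reduction

variable {Ω : ℕ → Type*} {F : Set (Problem Ω)} {K T : ℕ}

/-- The rounds of the bandit algorithm `A` on `K` copies of one decision set, reconstructed from
the queries and answers alone: the arms are those which `A` itself chooses. -/
def BanditAlg.roundsOnCopies (A : BanditAlg Ω K) (D : Domain) :
    List (E D.dim × Ω D.dim) → List (Observation Ω (fun _ : Fin K => D))
  | [] => []
  | q :: h => ⟨(A (fun _ => D) (A.roundsOnCopies D h)).1, q⟩ :: A.roundsOnCopies D h

/-- The base algorithm which runs a bandit algorithm on `K` copies of one problem. -/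
def BanditAlg.onCopies (A : BanditAlg Ω K) : BaseAlg Ω :=
  fun D h => (A (fun _ => D) (A.roundsOnCopies D h)).2

theorem BanditAlg.history_const (A : BanditAlg Ω K) (P : Problem Ω) (t : ℕ) :
    A.history (fun _ => P) t = A.roundsOnCopies P.dom (A.onCopies.history P t) := by
  induction t with
  | zero => rfl
  | succ t ih =>
    rw [history, ih]
    rfl

theorem BanditAlg.choice_const (A : BanditAlg Ω K) (P : Problem Ω) (t : ℕ) :
    (A.choice (fun _ => P) t).2 = A.onCopies.query P t := by
  rw [choice, A.history_const]
  rfl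

theorem BanditAlg.Feasible.onCopies {A : BanditAlg Ω K} (hA : A.Feasible F) :
    A.onCopies.Feasible F := fun P hP t =>
  A.choice_const P t ▸ hA (fun _ => P) (fun _ => hP) t

theorem BanditAlg.regret_const (A : BanditAlg Ω K) (hK : 0 < K) (P : Problem Ω) (T : ℕ) :
    A.regret (fun _ => P) T =
      ∑ t ∈ Finset.range T, (P.f (A.onCopies.query P t) - P.minVal) := by
  have : Nonempty (Fin K) := ⟨⟨0, hK⟩⟩
  simp only [regret, ciInf_const, ← A.choice_const]

theorem RegretAtLeast.mono {b b' : ℝ} (h : RegretAtLeast F K T b) (hb : b' ≤ b) :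
    RegretAtLeast F K T b' := fun A hA =>
  let ⟨P, hP, hr⟩ := h A hA
  ⟨P, hP, hb.trans hr⟩

theorem sum_Icc_one_eq_sum_range {β : Type*} [AddCommMonoid β] (a : ℕ → β) (T : ℕ) :
    ∑ s ∈ Finset.Icc 1 T, a s = ∑ t ∈ Finset.range T, a (t + 1) := by
  rw [Finset.range_eq_Ico, Finset.sum_Ico_add', zero_add, Finset.Ico_add_one_right_eq_Icc]

theorem IsOracleLowerBound.regretAtLeast_sum {g : Problem Ω → ℕ → ℝ} {a : ℕ → ℝ}
    (hg : IsOracleLowerBound F g T) (ha : ∀ P ∈ F, ∀ s ∈ Finset.Icc 1 T, a s ≤ g P s)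
    (hK : 0 < K) : RegretAtLeast F K T (∑ s ∈ Finset.Icc 1 T, a s) := by
  intro A hA
  obtain ⟨P, hP, hgap⟩ := hg A.onCopies hA.onCopies
  refine ⟨fun _ => P, fun _ => hP, ?_⟩
  rw [A.regret_const hK, sum_Icc_one_eq_sum_range]
  refine Finset.sum_le_sum fun t ht => ?_
  rw [Finset.mem_range] at ht
  exact (ha P hP _ (Finset.mem_Icc.2 ⟨Nat.le_add_left 1 t, ht⟩)).trans (hgap t ht)

end Reduction

section Hardness

variable {Ω : ℕ → Type*} {F : Set (Problem Ω)} {g : Problem Ω → ℕ → ℝ} {T K : ℕ} {a b : ℕ → ℝ}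

theorem IsOracleLowerBound.regretAtLeast_cumHardness (hg : IsOracleLowerBound F g T)
    (hb : ∀ s ∈ Finset.Icc 1 T, BddBelow ((fun P => g P s) '' F)) (hK : 0 < K) :
    RegretAtLeast F K T (cumHardness F g T) :=
  hg.regretAtLeast_sum (fun P hP s hs => csInf_le (hb s hs) ⟨P, hP, rfl⟩) hK

theorem iInf_sum_le_of_zero {G : ℕ → ℝ} (hG : G 0 = 0) (hK : 0 < K) (T : ℕ) :
    (⨅ k : {k : Fin K → ℕ // ∑ i, k i = T}, ∑ i, G (k.1 i)) ≤ G T := by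
  have hbound : {k : Fin K → ℕ | ∑ i, k i = T} ⊆ Set.Iic fun _ => T := by
    rintro k rfl i
    exact Finset.single_le_sum (fun _ _ => Nat.zero_le _) (Finset.mem_univ i)
  have : Finite {k : Fin K → ℕ // ∑ i, k i = T} :=
    ((Set.finite_Iic _).subset hbound).to_subtype
  let single : {k : Fin K → ℕ // ∑ i, k i = T} := ⟨Pi.single ⟨0, hK⟩ T, by simp⟩
  refine (ciInf_le (Set.finite_range _).bddBelow single).trans_eq ?_
  rw [Finset.sum_eq_single ⟨0, hK⟩ (fun i _ hi => by simp [single, hi, hG]) (by simp)]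
  simp [single]

/-- An unbounded below image has the junk infimum `0`. -/
theorem bddBelow_of_hardness_pos {s : ℕ} (h : 0 < hardness F g s) :
    BddBelow ((fun P => g P s) '' F) := by
  by_contra hb
  exact h.ne' (Real.sInf_of_not_bddBelow hb)

theorem IsOracleLowerBound.rate_of_le_hardness (hg : IsOracleLowerBound F g T) (hT : 0 < T)
    (hK : 0 < K) (ha : ∀ s ∈ Finset.Icc 1 T, 0 < a s)
    (hh : ∀ s ∈ Finset.Icc 1 T, a s ≤ hardness F g s)
    (hab : ∀ m ∈ Finset.Icc 1 T, b m ≤ ∑ s ∈ Finset.Icc 1 m, a s) :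
    (∀ m ∈ Finset.Icc 1 T, b m ≤ cumHardness F g m) ∧ RegretAtLeast F K T (b T) := by
  have hG : ∀ m ∈ Finset.Icc 1 T, b m ≤ cumHardness F g m := fun m hm =>
    (hab m hm).trans <| Finset.sum_le_sum fun s hs => hh s <|
      Finset.Icc_subset_Icc_right (Finset.mem_Icc.1 hm).2 hs
  have hbdd : ∀ s ∈ Finset.Icc 1 T, BddBelow ((fun P => g P s) '' F) := fun s hs =>
    bddBelow_of_hardness_pos ((ha s hs).trans_le (hh s hs))
  exact ⟨hG, (hg.regretAtLeast_cumHardness hbdd hK).mono (hG T (Finset.mem_Icc.2 ⟨hT, le_rfl⟩))⟩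

theorem sqrt_le_sum_one_div_sqrt (m : ℕ) :
    √(m : ℝ) ≤ ∑ s ∈ Finset.Icc 1 m, 1 / √(s : ℝ) :=
  calc √(m : ℝ) = ∑ _s ∈ Finset.Icc 1 m, 1 / √(m : ℝ) := by
        simp only [Finset.sum_const, Nat.card_Icc, Nat.add_sub_cancel, nsmul_eq_mul, mul_one_div,
          Real.div_sqrt]
    _ ≤ _ := Finset.sum_le_sum fun s hs => by
        have hs := Finset.mem_Icc.1 hs
        have : (1 : ℝ) ≤ s := mod_cast hs.1
        gcongr
        exact hs.2

theorem log_le_sum_inv (m : ℕ) :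
    Real.log m ≤ ∑ s ∈ Finset.Icc 1 m, (s : ℝ)⁻¹ := by
  have h := log_le_harmonic_floor (m : ℝ) (Nat.cast_nonneg m)
  rw [Nat.floor_natCast, harmonic_eq_sum_Icc] at h
  simpa only [Rat.cast_sum, Rat.cast_inv, Rat.cast_natCast] using h

theorem IsOracleLowerBound.rate_of_div_sqrt_le_hardness (hg : IsOracleLowerBound F g T)
    (hT : 0 < T) (hK : 0 < K) {C : ℝ} (hC : 0 < C)
    (hh : ∀ s ∈ Finset.Icc 1 T, C / √(s : ℝ) ≤ hardness F g s) :
    (∀ m ∈ Finset.Icc 1 T, C * √(m : ℝ) ≤ cumHardness F g m) ∧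
      RegretAtLeast F K T (C * √(T : ℝ)) := by
  refine hg.rate_of_le_hardness (b := fun m => C * √(m : ℝ)) hT hK (fun s hs => ?_) hh
    fun m _ => ?_
  · have : (0 : ℝ) < s := Nat.cast_pos.2 (Finset.mem_Icc.1 hs).1
    positivity
  · simp only [← mul_one_div C, ← Finset.mul_sum]
    gcongr
    exact sqrt_le_sum_one_div_sqrt m

theorem IsOracleLowerBound.rate_of_div_le_hardness (hg : IsOracleLowerBound F g T)
    (hT : 0 < T) (hK : 0 < K) {C : ℝ} (hC : 0 < C)
    (hh : ∀ s ∈ Finset.Icc 1 T, C / (s : ℝ) ≤ hardness F g s) :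
    (∀ m ∈ Finset.Icc 1 T, C * Real.log m ≤ cumHardness F g m) ∧
      RegretAtLeast F K T (C * Real.log T) := by
  refine hg.rate_of_le_hardness (b := fun m => C * Real.log m) hT hK (fun s hs => ?_) hh
    fun m _ => ?_
  · have : (0 : ℝ) < s := Nat.cast_pos.2 (Finset.mem_Icc.1 hs).1
    positivity
  · simp only [div_eq_mul_inv, ← Finset.mul_sum]
    gcongr
    exact log_le_sum_inv m

theorem IsOracleLowerBound.rate_of_first_le_hardness (hg : IsOracleLowerBound F g T)
    (hT : 0 < T) (hK : 0 < K) {C : ℝ} (hC : C ≤ a 1) (ha : ∀ s ∈ Finset.Icc 1 T, 0 < a s)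
    (hh : ∀ s ∈ Finset.Icc 1 T, a s ≤ hardness F g s) :
    (∀ m ∈ Finset.Icc 1 T, C ≤ cumHardness F g m) ∧ RegretAtLeast F K T C := by
  refine hg.rate_of_le_hardness (b := fun _ => C) hT hK ha hh fun m hm => hC.trans ?_
  have hm := Finset.mem_Icc.1 hm
  exact Finset.single_le_sum
    (fun s hs => (ha s (Finset.Icc_subset_Icc_right hm.2 hs)).le) (Finset.mem_Icc.2 ⟨le_rfl, hm.1⟩)

theorem IsOracleLowerBound.rate_of_exp_le_hardness (hg : IsOracleLowerBound F g T)
    (hT : 0 < T) (hK : 0 < K) {C κ : ℝ} (hC : 0 < C) (hκ : 1 ≤ κ)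
    (hh : ∀ s ∈ Finset.Icc 1 T, C * Real.exp (-(s : ℝ) / √κ) ≤ hardness F g s) :
    (∀ m ∈ Finset.Icc 1 T, C * Real.exp (-1) ≤ cumHardness F g m) ∧
      RegretAtLeast F K T (C * Real.exp (-1)) := by
  refine hg.rate_of_first_le_hardness hT hK ?_ (fun s _ => by positivity) hh
  have hinv : 1 / √κ ≤ 1 := div_le_one_of_le₀ (Real.one_le_sqrt.2 hκ) (Real.sqrt_nonneg _)
  rw [Nat.cast_one, neg_div]
  gcongr

end Hardness

section Subgradient

variable {V : Type*} [NormedAddCommGroup V] [InnerProductSpace ℝ V] {μ C : ℝ} {f : V → ℝ}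
  {s : V → V}

/-- `s x` is a subgradient of the `μ`-strongly convex function `f` at every point `x`. -/
def IsStrongSubgradient (μ : ℝ) (f : V → ℝ) (s : V → V) : Prop :=
  ∀ x y, f x + ⟪s x, y - x⟫ + μ / 2 * ‖x - y‖ ^ 2 ≤ f y

theorem IsStrongSubgradient.le (h : IsStrongSubgradient μ f s) (hμ : 0 ≤ μ) (x y : V) :
    f x + ⟪s x, y - x⟫ ≤ f y :=
  (le_add_of_nonneg_right (by positivity)).trans (h x y)

theorem IsStrongSubgradient.convexOn (h : IsStrongSubgradient μ f s) (hμ : 0 ≤ μ) :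
    ConvexOn ℝ Set.univ f := by
  refine ⟨convex_univ, fun x _ y _ a b ha hb hab => ?_⟩
  set z := a • x + b • y with hz
  have hcancel : a * ⟪s z, x - z⟫ + b * ⟪s z, y - z⟫ = 0 := by
    rw [← real_inner_smul_right, ← real_inner_smul_right, ← inner_add_right,
      show a • (x - z) + b • (y - z) = (a • x + b • y) - (a + b) • z by module, hab, one_smul,
      ← hz, sub_self, inner_zero_right]
  calc f z = a * (f z + ⟪s z, x - z⟫) + b * (f z + ⟪s z, y - z⟫) := by
        linear_combination -f z * hab - hcancel
    _ ≤ a • f x + b • f y := by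
        rw [smul_eq_mul, smul_eq_mul]
        gcongr
        exacts [h.le hμ z x, h.le hμ z y]

theorem IsStrongSubgradient.abs_sub_le (h : IsStrongSubgradient μ f s) (hμ : 0 ≤ μ) {x y : V}
    (hx : ‖s x‖ ≤ C) (hy : ‖s y‖ ≤ C) : |f x - f y| ≤ C * ‖x - y‖ := by
  have one_sided : ∀ x y : V, ‖s x‖ ≤ C → f x - f y ≤ C * ‖x - y‖ := fun x y hx =>
    calc f x - f y ≤ ⟪s x, x - y⟫ := by
          rw [← neg_sub y x, inner_neg_right]
          linarith [h.le hμ x y]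
      _ ≤ ‖s x‖ * ‖x - y‖ := real_inner_le_norm _ _
      _ ≤ C * ‖x - y‖ := by gcongr
  exact abs_sub_le_iff.2 ⟨one_sided x y hx, norm_sub_rev x y ▸ one_sided y x hy⟩

theorem half_mul_norm_sq_eq_add (μ : ℝ) (x y : V) :
    μ / 2 * ‖y‖ ^ 2 = μ / 2 * ‖x‖ ^ 2 + ⟪μ • x, y - x⟫ + μ / 2 * ‖x - y‖ ^ 2 := by
  rw [norm_sub_sq_real, real_inner_smul_left, inner_sub_right, real_inner_self_eq_norm_sq]
  ring

theorem half_mul_norm_sub_sq_eq_add (μ : ℝ) (a x y : V) :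
    μ / 2 * ‖y - a‖ ^ 2 =
      μ / 2 * ‖x - a‖ ^ 2 + ⟪μ • (x - a), y - x⟫ + μ / 2 * ‖x - y‖ ^ 2 := by
  simpa only [sub_sub_sub_cancel_right] using half_mul_norm_sq_eq_add μ (x - a) (y - a)

theorem isStrongSubgradient_half_mul_norm_sub_sq (μ : ℝ) (a : V) :
    IsStrongSubgradient μ (fun x => μ / 2 * ‖x - a‖ ^ 2) (fun x => μ • (x - a)) := fun x y =>
  (half_mul_norm_sub_sq_eq_add μ a x y).ge

theorem hasGradientAt_half_mul_norm_sub_sq [CompleteSpace V] (μ : ℝ) (a x : V) :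
    HasGradientAt (fun x => μ / 2 * ‖x - a‖ ^ 2) (μ • (x - a)) x := by
  rw [hasGradientAt_iff_hasFDerivAt]
  refine ((((hasFDerivAt_id x).sub_const a).norm_sq).const_mul (μ / 2)).congr_fderiv ?_
  ext y
  simp only [id_eq, nsmul_eq_mul, Nat.cast_ofNat, smul_apply,
    ContinuousLinearMap.comp_apply, ContinuousLinearMap.id_apply, innerSL_apply_apply, smul_eq_mul,
    map_smul, InnerProductSpace.toDual_apply_apply]
  ring

end Subgradient

section BallProblem

variable {n : ℕ} {r μ M M' C : ℝ} {f : E n → ℝ} {s : E n → E n}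

/-- The problem of minimizing a convex function `f` on the closed ball with centre `0` and radius
`r`, with a first-order oracle which answers by `s x` as the subgradient at `x`. -/
noncomputable def ballProblem (hr : 0 ≤ r) (hf : ConvexOn ℝ Set.univ f) (s : E n → E n) :
    Problem FirstOrder where
  dom := ⟨n, Metric.closedBall 0 r⟩
  f := f
  oracle x := (f x, s x)
  convex_dom := convex_closedBall 0 r
  convex_f := hf.subset (Set.subset_univ _) (convex_closedBall 0 r)
  exists_min := (isCompact_closedBall 0 r).exists_isMinOn ⟨0, Metric.mem_closedBall_self hr⟩
    hf.locallyLipschitz.continuous.continuousOn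

theorem ballProblem_inClass (hr : 0 ≤ r) (hμ : 0 ≤ μ) (h : IsStrongSubgradient μ f s)
    (hs : ∀ x ∈ Metric.closedBall 0 r, ‖s x‖ ≤ C) :
    InClass μ 0 (2 * C) (ballProblem hr (h.convexOn hμ) s) where
  convex := h.convexOn hμ
  value _ _ := rfl
  isSubgrad x _ y := h.le hμ x y
  lower := fun (x : E n) _ (y : E n) _ =>
    le_sub_iff_add_le'.2 (le_sub_iff_add_le'.2 ((add_assoc _ _ _).ge.trans (h x y)))
  upper := fun (x : E n) hx (y : E n) hy => by
    have hf := neg_le_of_abs_le (h.abs_sub_le hμ (hs x hx) (hs y hy))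
    have hinner : ⟪s x, x - y⟫ ≤ C * ‖x - y‖ :=
      (real_inner_le_norm _ _).trans (by gcongr; exact hs x hx)
    rw [← neg_sub y x, inner_neg_right, neg_sub] at hinner
    change f y - f x - ⟪s x, y - x⟫ ≤ 0 / 2 * ‖x - y‖ ^ 2 + 2 * C * ‖x - y‖
    linarith

theorem ballProblem_isLip (hr : 0 ≤ r) (hμ : 0 ≤ μ) (h : IsStrongSubgradient μ f s)
    (hs : ∀ x ∈ Metric.closedBall 0 r, ‖s x‖ ≤ C) :
    IsLip C (ballProblem hr (h.convexOn hμ) s) := fun x hx y hy =>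
  h.abs_sub_le hμ (hs x hx) (hs y hy)

theorem IsLip.mono {P : Problem FirstOrder} (h : IsLip M P) (hM : M ≤ M') : IsLip M' P :=
  fun x hx y hy => (h x hx y hy).trans (by gcongr)

theorem Problem.minVal_le {Ω : ℕ → Type*} (P : Problem Ω) {x : E P.dom.dim}
    (hx : x ∈ P.dom.carrier) : P.minVal ≤ P.f x := by
  obtain ⟨z, -, hz⟩ := P.exists_min
  exact csInf_le ⟨P.f z, Set.forall_mem_image.2 hz⟩ ⟨x, hx, rfl⟩

theorem hasDiam_of_dom_eq {P : Problem FirstOrder} {R : ℝ} (hn : 0 < n) (hR : 0 ≤ R)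
    (hP : P.dom = ⟨n, Metric.closedBall 0 (R / 2)⟩) : HasDiam R P := by
  have : Nonempty (Fin n) := ⟨⟨0, hn⟩⟩
  have : Nontrivial (E n) := inferInstance
  rw [HasDiam, hP, Metric.diam_closedBall_eq _ (by positivity)]
  exact ⟨Metric.isBounded_closedBall, by ring⟩

end BallProblem

section Smooth

variable {n T : ℕ} {μ L R : ℝ}

theorem exists_norm_le_le_norm_sub {V : Type*} [NormedAddCommGroup V] [NormedSpace ℝ V]
    [Nontrivial V] (x : V) {r : ℝ} (hr : 0 ≤ r) : ∃ a : V, ‖a‖ ≤ r ∧ r ≤ ‖x - a‖ := by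
  obtain ⟨e, he⟩ := exists_norm_eq V hr
  by_contra! hclose
  have hminus := hclose (-e) (by rw [norm_neg, he])
  have hdist : ‖(x - -e) - (x - e)‖ = 2 * r := by
    rw [show (x - -e) - (x - e) = (2 : ℝ) • e by module, norm_smul, he, Real.norm_two]
  linarith [hclose e he.le, norm_sub_le (x - -e) (x - e)]

theorem ballProblem_mem_strongSmoothClass (hn : 0 < n) (hR : 0 ≤ R) (hL : 0 ≤ L) (hμL : μ ≤ L)
    (a : E n) :
    ballProblem (div_nonneg hR zero_le_two)
      ((isStrongSubgradient_half_mul_norm_sub_sq L a).convexOn hL) (fun x => L • (x - a)) ∈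
        strongSmoothClass n μ L R := by
  set f : E n → ℝ := fun x => L / 2 * ‖x - a‖ ^ 2
  have hf := isStrongSubgradient_half_mul_norm_sub_sq L a
  have htaylor (x y : E n) : f y - f x - ⟪L • (x - a), y - x⟫ = L / 2 * ‖x - y‖ ^ 2 := by
    rw [sub_sub, sub_eq_iff_eq_add']
    exact half_mul_norm_sub_sq_eq_add L a x y
  have hgrad (x : E n) : HasGradientAt f (L • (x - a)) x :=
    hasGradientAt_half_mul_norm_sub_sq L a x
  refine ⟨rfl, hasDiam_of_dom_eq hn hR rfl, ?_, fun x => (hgrad x).differentiableAt,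
    fun (x : E n) (y : E n) => ?_⟩
  · refine ⟨hf.convexOn hL, fun _ _ => rfl, fun x _ y => hf.le hL x y,
      fun (x : E n) _ (y : E n) _ => ?_, fun (x : E n) _ (y : E n) _ => ?_⟩
    · exact (mul_le_mul_of_nonneg_right (by linarith) (sq_nonneg _)).trans_eq (htaylor x y).symm
    · exact (htaylor x y).le.trans (le_add_of_nonneg_right (zero_mul ‖x - y‖).ge)
  · change ‖gradient f x - gradient f y‖ ≤ L * ‖x - y‖
    rw [(hgrad x).gradient, (hgrad y).gradient, ← smul_sub, sub_sub_sub_cancel_right, norm_smul,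
      Real.norm_of_nonneg hL]

theorem isOracleLowerBound_strongSmoothClass (hn : 0 < n) (hR : 0 ≤ R) (hL : 0 ≤ L) (hμL : μ ≤ L)
    (T : ℕ) :
    IsOracleLowerBound (strongSmoothClass n μ L R)
      (fun _ => Pi.single 1 (1 / 8 * (L * R ^ 2))) T := by
  intro B hB
  have : Nonempty (Fin n) := ⟨⟨0, hn⟩⟩
  obtain ⟨a, ha, hfar⟩ := exists_norm_le_le_norm_sub
    (B ⟨n, Metric.closedBall 0 (R / 2)⟩ []) (div_nonneg hR zero_le_two)
  have hP := ballProblem_mem_strongSmoothClass hn hR hL hμL a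
  set P := ballProblem (div_nonneg hR zero_le_two)
    ((isStrongSubgradient_half_mul_norm_sub_sq L a).convexOn hL) (fun x => L • (x - a))
  refine ⟨P, hP, fun t _ => ?_⟩
  rcases t with _ | t
  · have hmin : P.minVal ≤ 0 := (P.minVal_le (mem_closedBall_zero_iff.2 ha)).trans_eq <| by
      change L / 2 * ‖a - a‖ ^ 2 = 0
      rw [sub_self, norm_zero]
      ring
    have hfirst : L / 2 * (R / 2) ^ 2 ≤ P.f (B.query P 0) :=
      mul_le_mul_of_nonneg_left (pow_le_pow_left₀ (by positivity) hfar 2) (by positivity)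
    simp only [zero_add, Pi.single_eq_same]
    linarith
  · have hlater : Pi.single (M := fun _ => ℝ) 1 (1 / 8 * (L * R ^ 2)) (t + 1 + 1) = 0 :=
      Pi.single_eq_of_ne (Nat.succ_ne_succ_iff.2 t.succ_ne_zero) _
    exact hlater.trans_le (sub_nonneg.2 (P.minVal_le (hB P hP (t + 1))))

theorem regretAtLeast_strongSmoothClass {K : ℕ} (hn : 0 < n) (hR : 0 ≤ R) (hL : 0 ≤ L)
    (hμL : μ ≤ L) (hT : 0 < T) (hK : 0 < K) :
    RegretAtLeast (strongSmoothClass n μ L R) K T (1 / 8 * (L * R ^ 2)) := by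
  have h := (isOracleLowerBound_strongSmoothClass hn hR hL hμL T).regretAtLeast_sum
    (fun _ _ _ _ => le_rfl) hK
  rwa [Finset.sum_pi_single', if_pos (Finset.mem_Icc.2 ⟨le_rfl, hT⟩)] at h

end Smooth

section RegMax

variable {ι : Type*} [LinearOrder ι] [Finite ι] [Nonempty ι]

/-- The smallest index at which the finite family `a` is maximal. Breaking ties in this way keeps
the oracle of the hard function from revealing slopes too early. -/
noncomputable def firstArgmax (a : ι → ℝ) : ι :=
  wellFounded_lt.min {j | ∀ i, a i ≤ a j} (Finite.exists_max a)

theorem le_firstArgmax (a : ι → ℝ) (i : ι) : a i ≤ a (firstArgmax a) :=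
  wellFounded_lt.min_mem {j | ∀ i, a i ≤ a j} (Finite.exists_max a) i

theorem firstArgmax_le {a : ι → ℝ} {j : ι} (hj : ∀ i, a i ≤ a j) : firstArgmax a ≤ j :=
  wellFounded_lt.min_le (s := {j | ∀ i, a i ≤ a j}) hj

theorem firstArgmax_le_of_forall_ge_eq {a : ι → ℝ} {t : ι} (h : ∀ j, t ≤ j → a j = a t) :
    firstArgmax a ≤ t := by
  by_contra! hlt
  exact hlt.not_ge (firstArgmax_le fun i => (le_firstArgmax a i).trans_eq (h _ hlt.le))

theorem firstArgmax_eq_of_forall_le_eq {a b : ι → ℝ} {t : ι} (h : ∀ j ≤ t, a j = b j)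
    (ha : firstArgmax a ≤ t) (hb : firstArgmax b ≤ t) : firstArgmax a = firstArgmax b :=
  le_antisymm
    (firstArgmax_le fun i => (le_firstArgmax a i).trans <| by
      rw [h _ ha, h _ hb]
      exact le_firstArgmax b _)
    (firstArgmax_le fun i => (le_firstArgmax b i).trans <| by
      rw [← h _ ha, ← h _ hb]
      exact le_firstArgmax a _)

variable {V : Type*} [NormedAddCommGroup V] [InnerProductSpace ℝ V]

/-- The function `μ/2 ‖x‖² + max_j ⟪d_j, x⟫`, which is hard for the Lipschitz classes. -/
noncomputable def regMax (μ : ℝ) (d : ι → V) (x : V) : ℝ :=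
  μ / 2 * ‖x‖ ^ 2 + ⟪d (firstArgmax fun j => ⟪d j, x⟫), x⟫

/-- The subgradient of `regMax` which is given by the first maximal linear form. -/
noncomputable def regMaxGrad (μ : ℝ) (d : ι → V) (x : V) : V :=
  μ • x + d (firstArgmax fun j => ⟪d j, x⟫)

theorem le_regMax (μ : ℝ) (d : ι → V) (x : V) (j : ι) :
    μ / 2 * ‖x‖ ^ 2 + ⟪d j, x⟫ ≤ regMax μ d x :=
  (add_le_add_iff_left _).2 (le_firstArgmax (fun j => ⟪d j, x⟫) j)

theorem isStrongSubgradient_regMax (μ : ℝ) (d : ι → V) :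
    IsStrongSubgradient μ (regMax μ d) (regMaxGrad μ d) := fun x y => by
  refine le_of_eq_of_le ?_ (le_regMax μ d y (firstArgmax fun j => ⟪d j, x⟫))
  rw [regMax, regMaxGrad, half_mul_norm_sq_eq_add μ x y, inner_add_left, inner_sub_right (d _)]
  ring

end RegMax

theorem norm_sum_smul_sq {ι V : Type*} [NormedAddCommGroup V] [InnerProductSpace ℝ V] {u : ι → V}
    (hu : Orthonormal ℝ u) (w : ι → ℝ) (s : Finset ι) :
    ‖∑ i ∈ s, w i • u i‖ ^ 2 = ∑ i ∈ s, w i ^ 2 := by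
  rw [← real_inner_self_eq_norm_sq, hu.inner_sum]
  exact Finset.sum_congr rfl fun i _ => (sq (w i)).symm

theorem sum_Iio_add_sum_Ici {ι β : Type*} [LinearOrder ι] [Fintype ι] [LocallyFiniteOrderBot ι]
    [LocallyFiniteOrderTop ι] [AddCommMonoid β] (a : ι → β) (t : ι) :
    ∑ i ∈ Finset.Iio t, a i + ∑ i ∈ Finset.Ici t, a i = ∑ i, a i := by
  simpa only [Finset.filter_gt_eq_Iio, not_lt, Finset.filter_le_eq_Ici] using
    Finset.sum_filter_add_sum_filter_not Finset.univ (· < t) a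

section Slope

variable {ι V : Type*} [LinearOrder ι] [LocallyFiniteOrderBot ι] [NormedAddCommGroup V]
  [InnerProductSpace ℝ V] {M μ r : ℝ} {w : ι → ℝ} {u v : ι → V}

/-- The slopes `M u_j + μ ∑_{i < j} w_i u_i` of the linear forms in the hard function. -/
noncomputable def slope (M μ : ℝ) (w : ι → ℝ) (u : ι → V) (j : ι) : V :=
  M • u j + μ • ∑ i ∈ Finset.Iio j, w i • u i

theorem slope_congr {j : ι} (h : ∀ i ≤ j, u i = v i) : slope M μ w u j = slope M μ w v j := by
  rw [slope, slope, h j le_rfl,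
    Finset.sum_congr rfl fun i hi => by rw [h i (Finset.mem_Iio.1 hi).le]]

theorem inner_slope_of_orthogonal {x : V} {t : ι} (hx : ∀ i, t ≤ i → ⟪u i, x⟫ = 0) {j : ι}
    (hj : t ≤ j) : ⟪slope M μ w u j, x⟫ = μ * ⟪∑ i ∈ Finset.Iio t, w i • u i, x⟫ := by
  have htail : ∑ i ∈ Finset.Iio j, ⟪w i • u i, x⟫ = ∑ i ∈ Finset.Iio t, ⟪w i • u i, x⟫ :=
    (Finset.sum_subset (Finset.Iio_subset_Iio hj) fun i _ hi => by
      rw [real_inner_smul_left, hx i (not_lt.1 (mt Finset.mem_Iio.2 hi)), mul_zero]).symm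
  rw [slope, inner_add_left, real_inner_smul_left, hx j hj, mul_zero, zero_add,
    real_inner_smul_left, sum_inner, sum_inner, htail]

theorem norm_slope_le (hu : Orthonormal ℝ u) (hμ : 0 ≤ μ) (hM : 0 ≤ M) (hr : 0 ≤ r)
    {j : ι} (hw : ∑ i ∈ Finset.Iio j, w i ^ 2 ≤ r ^ 2) :
    ‖slope M μ w u j‖ ≤ M + μ * r := by
  have hsum : ‖∑ i ∈ Finset.Iio j, w i • u i‖ ≤ r :=
    (pow_le_pow_iff_left₀ (norm_nonneg _) hr two_ne_zero).1 <|
      (norm_sum_smul_sq hu w _).trans_le hw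
  calc ‖slope M μ w u j‖ ≤ M * ‖u j‖ + μ * ‖∑ i ∈ Finset.Iio j, w i • u i‖ := by
        refine (norm_add_le _ _).trans_eq ?_
        rw [norm_smul, norm_smul, Real.norm_of_nonneg hM, Real.norm_of_nonneg hμ]
    _ ≤ M + μ * r := by
        rw [hu.norm_eq_one, mul_one]
        gcongr

variable [Nonempty ι]

theorem neg_le_regMax_slope [Finite ι] (hu : Orthonormal ℝ u) (hμ : 0 ≤ μ) {x : V} {t : ι}
    (hx : ∀ i, t ≤ i → ⟪u i, x⟫ = 0) :
    -(μ / 2 * ∑ i ∈ Finset.Iio t, w i ^ 2) ≤ regMax μ (slope M μ w u) x := by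
  set c := ∑ i ∈ Finset.Iio t, w i • u i
  calc -(μ / 2 * ∑ i ∈ Finset.Iio t, w i ^ 2) ≤ μ / 2 * ‖x + c‖ ^ 2 - μ / 2 * ‖c‖ ^ 2 := by
        rw [← norm_sum_smul_sq hu w, neg_eq_zero_sub]
        gcongr
        positivity
    _ = μ / 2 * ‖x‖ ^ 2 + ⟪slope M μ w u t, x⟫ := by
        rw [inner_slope_of_orthogonal hx le_rfl, norm_add_sq_real, real_inner_comm]
        ring
    _ ≤ regMax μ (slope M μ w u) x := le_regMax _ _ _ _

variable [Fintype ι] [LocallyFiniteOrderTop ι]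

theorem regMax_slope_le (hu : Orthonormal ℝ u) {δ : ℝ}
    (hw : ∀ j, δ + μ * ∑ i ∈ Finset.Ici j, w i ^ 2 ≤ M * w j) :
    regMax μ (slope M μ w u) (-∑ i, w i • u i) ≤ -δ - μ / 2 * ∑ i, w i ^ 2 := by
  have hinner (j : ι) : ⟪slope M μ w u j, -∑ i, w i • u i⟫ =
      -(M * w j) - μ * ∑ i ∈ Finset.Iio j, w i ^ 2 := by
    have hpartial : ⟪∑ i ∈ Finset.Iio j, w i • u i, ∑ i, w i • u i⟫ =
        ∑ i ∈ Finset.Iio j, w i ^ 2 := by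
      simp only [sum_inner, real_inner_smul_left, hu.inner_right_fintype, sq]
    rw [slope, inner_neg_right, inner_add_left, real_inner_smul_left, real_inner_smul_left,
      hu.inner_right_fintype, hpartial, neg_add']
  set j := firstArgmax fun j => ⟪slope M μ w u j, -∑ i, w i • u i⟫ with hj
  rw [regMax, norm_neg, norm_sum_smul_sq hu, ← hj, hinner, ← sum_Iio_add_sum_Ici _ j]
  linarith [hw j]

theorem le_regMax_slope_sub_regMax_slope (hu : Orthonormal ℝ u) (hμ : 0 ≤ μ) {δ : ℝ}
    (hw : ∀ j, δ + μ * ∑ i ∈ Finset.Ici j, w i ^ 2 ≤ M * w j) {x : V} {t : ι}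
    (hx : ∀ i, t ≤ i → ⟪u i, x⟫ = 0) :
    δ + μ / 2 * ∑ i ∈ Finset.Ici t, w i ^ 2 ≤
      regMax μ (slope M μ w u) x - regMax μ (slope M μ w u) (-∑ i, w i • u i) := by
  have hlow := neg_le_regMax_slope (M := M) (w := w) hu hμ hx
  have hup := regMax_slope_le hu hw
  have hsplit := sum_Iio_add_sum_Ici (fun i => w i ^ 2) t
  rw [← hsplit] at hup
  linarith

end Slope

section Resisting

/-- The queries of a deterministic algorithm `a` and the answers of the oracle `o` in the first
`t` steps, most recent first. -/
def transcript {α β : Type*} (a : List (α × β) → α) (o : α → β) : ℕ → List (α × β)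
  | 0 => []
  | t + 1 => (a (transcript a o t), o (a (transcript a o t))) :: transcript a o t

theorem transcript_congr {α β : Type*} {a : List (α × β) → α} {o o' : α → β} {t : ℕ}
    (h : ∀ s < t, o' (a (transcript a o s)) = o (a (transcript a o s))) :
    transcript a o' t = transcript a o t := by
  induction t with
  | zero => rfl
  | succ t ih =>
    rw [transcript, transcript, ih fun s hs => h s (hs.trans t.lt_succ_self), h t t.lt_succ_self]

theorem BaseAlg.history_eq_transcript {Ω : ℕ → Type*} (B : BaseAlg Ω) (P : Problem Ω) (t : ℕ) :
    B.history P t = transcript (B P.dom) P.oracle t := by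
  induction t with
  | zero => rfl
  | succ t ih => rw [history, transcript, ih]

variable {V β : Type*} [NormedAddCommGroup V] [InnerProductSpace ℝ V] {T : ℕ}

theorem exists_unit_orthogonal {ι : Type*} [Fintype ι] (v : ι → V)
    (hv : Fintype.card ι < Module.finrank ℝ V) : ∃ e : V, ‖e‖ = 1 ∧ ∀ i, ⟪v i, e⟫ = 0 := by
  have : FiniteDimensional ℝ V := .of_finrank_pos (hv.trans_le' (Nat.zero_le _))
  have hspan : Submodule.span ℝ (Set.range v) ≠ ⊤ := fun h =>
    (finrank_range_le_card (R := ℝ) v).not_gt <| by rwa [Set.finrank, h, finrank_top]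
  obtain ⟨z, hz, hz0⟩ := Submodule.exists_mem_ne_zero_of_ne_bot
    (mt Submodule.orthogonal_eq_bot_iff.1 hspan)
  refine ⟨‖z‖⁻¹ • z, norm_smul_inv_norm (𝕜 := ℝ) hz0, fun i => ?_⟩
  rw [real_inner_smul_right, Submodule.inner_right_of_mem_orthogonal
    (Submodule.subset_span (Set.mem_range_self i)) hz, mul_zero]

/-- The answer of an oracle with parameters `u_0, …, u_{T-1}` to a query orthogonal to
`u_t, u_{t+1}, …` depends on `u_0, …, u_t` only, so that `u_t` may be chosen
when the query number `t` is known. -/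
def RevealsInOrder (o : (Fin T → V) → V → β) : Prop :=
  ∀ (u v : Fin T → V) (x : V) (t : Fin T), (∀ i ≤ t, u i = v i) →
    (∀ i, t ≤ i → ⟪u i, x⟫ = 0) → (∀ i, t ≤ i → ⟪v i, x⟫ = 0) → o u x = o v x

/-- A stage of the construction of the resisting parameters: the first `k` have been fixed,
orthonormal and each orthogonal to the queries made so far; those not yet fixed are `0`. -/
structure IsResistingUpTo (a : List (V × β) → V) (o : (Fin T → V) → V → β) (k : ℕ)
    (u : Fin T → V) : Prop where
  norm_eq_one : ∀ i : Fin T, (i : ℕ) < k → ‖u i‖ = 1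
  eq_zero : ∀ i : Fin T, k ≤ i → u i = 0
  orthogonal : ∀ i j, i ≠ j → ⟪u i, u j⟫ = 0
  orthogonal_query : ∀ (t : ℕ) (i : Fin T), t ≤ i → ⟪u i, a (transcript a (o u) t)⟫ = 0

theorem IsResistingUpTo.update {a : List (V × β) → V} {o : (Fin T → V) → V → β}
    (ho : RevealsInOrder o) {k : Fin T} {u : Fin T → V} (hu : IsResistingUpTo a o k u) {e : V}
    (he : ‖e‖ = 1) (heu : ∀ i, i ≠ k → ⟪u i, e⟫ = 0)
    (heq : ∀ t ≤ (k : ℕ), ⟪a (transcript a (o u) t), e⟫ = 0) :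
    IsResistingUpTo a o (k + 1) (Function.update u k e) := by
  set v := Function.update u k e
  have hvk : v k = e := Function.update_self k e u
  have hv {i : Fin T} (hi : i ≠ k) : v i = u i := Function.update_of_ne hi e u
  have hquery {t : ℕ} {i : Fin T} (hti : t ≤ i) (htk : t ≤ (k : ℕ)) :
      ⟪v i, a (transcript a (o u) t)⟫ = 0 := by
    rcases eq_or_ne i k with rfl | hik
    · rw [hvk, real_inner_comm, heq t htk]
    · rw [hv hik, hu.orthogonal_query t i hti]
  have hpast {t : ℕ} (ht : t ≤ (k : ℕ)) : transcript a (o v) t = transcript a (o u) t :=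
    transcript_congr fun s hs => by
      have hsk := hs.trans_le ht
      exact ho v u _ ⟨s, hsk.trans k.2⟩ (fun i hi => hv (ne_of_lt (hi.trans_lt hsk)))
        (fun i hi => hquery hi hsk.le) fun i hi => hu.orthogonal_query s i hi
  refine ⟨fun i hi => ?_, fun i hi => ?_, fun i j hij => ?_, fun t i hti => ?_⟩
  · rcases eq_or_ne i k with rfl | hik
    · rw [hvk, he]
    · rw [hv hik, hu.norm_eq_one i (by lia)]
  · rw [hv (by lia), hu.eq_zero i (by lia)]
  · rcases eq_or_ne i k with rfl | hik
    · rw [hvk, hv hij.symm, real_inner_comm, heu j hij.symm]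
    · rcases eq_or_ne j k with rfl | hjk
      · rw [hvk, hv hij, heu i hij]
      · rw [hv hik, hv hjk, hu.orthogonal i j hij]
  · rcases le_or_gt i k with hik | hki
    · rw [hpast (hti.trans hik), hquery hti (hti.trans hik)]
    · rw [hv hki.ne', hu.eq_zero i hki.le, inner_zero_left]

theorem exists_isResistingUpTo (hT : 2 * T ≤ Module.finrank ℝ V) {o : (Fin T → V) → V → β}
    (ho : RevealsInOrder o) (a : List (V × β) → V) {k : ℕ} (hk : k ≤ T) :
    ∃ u, IsResistingUpTo a o k u := by
  induction k with
  | zero =>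
    exact ⟨0, fun i hi => absurd hi i.1.not_lt_zero, fun _ _ => rfl,
      fun _ _ _ => inner_zero_left _, fun _ _ _ => inner_zero_left _⟩
  | succ k ih =>
    obtain ⟨u, hu⟩ := ih (Nat.le_of_succ_le hk)
    obtain ⟨e, he, horth⟩ := exists_unit_orthogonal
      (Sum.elim (fun i : {i : Fin T // i ≠ ⟨k, hk⟩} => u i)
        fun t : Fin (k + 1) => a (transcript a (o u) t)) (by
          simp only [Fintype.card_sum, Fintype.card_fin, ne_eq, Fintype.card_subtype_compl,
            Fintype.card_unique]
          lia)
    exact ⟨_, IsResistingUpTo.update (k := ⟨k, hk⟩) ho hu he (fun i hi => horth (.inl ⟨i, hi⟩))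
      fun t ht => horth (.inr ⟨t, Nat.lt_succ_of_le ht⟩)⟩

theorem RevealsInOrder.exists_orthonormal {o : (Fin T → V) → V → β} (ho : RevealsInOrder o)
    (hT : 2 * T ≤ Module.finrank ℝ V) (a : List (V × β) → V) :
    ∃ u : Fin T → V, Orthonormal ℝ u ∧
      ∀ (t : ℕ) (i : Fin T), t ≤ i → ⟪u i, a (transcript a (o u) t)⟫ = 0 := by
  obtain ⟨u, hu⟩ := exists_isResistingUpTo hT ho a le_rfl
  exact ⟨u, ⟨fun i => hu.norm_eq_one i i.2, fun i j => hu.orthogonal i j⟩, hu.orthogonal_query⟩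

theorem revealsInOrder_regMax_slope [NeZero T] (M μ : ℝ) (w : Fin T → ℝ) :
    RevealsInOrder fun (u : Fin T → V) x =>
      (regMax μ (slope M μ w u) x, regMaxGrad μ (slope M μ w u) x) := by
  intro u v x t huv hu hv
  have hslope : ∀ j ≤ t, slope M μ w u j = slope M μ w v j := fun j hj =>
    slope_congr fun i hi => huv i (hi.trans hj)
  have hfirst {u : Fin T → V} (hu : ∀ i, t ≤ i → ⟪u i, x⟫ = 0) :
      (firstArgmax fun j => ⟪slope M μ w u j, x⟫) ≤ t :=
    firstArgmax_le_of_forall_ge_eq fun j hj => by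
      rw [inner_slope_of_orthogonal hu hj, inner_slope_of_orthogonal hu le_rfl]
  have heq := firstArgmax_eq_of_forall_le_eq (fun j hj => by rw [hslope j hj]) (hfirst hu)
    (hfirst hv)
  simp only [regMax, regMaxGrad, ← heq, hslope _ (hfirst hu)]

end Resisting

section Nonsmooth

variable {n T K : ℕ} {μ M r δ : ℝ}

theorem exists_resisting_problem [NeZero T] (hn : 2 * T ≤ n) (hμ : 0 ≤ μ) (hr : 0 ≤ r)
    (hμr : μ * r ≤ M) {w : Fin T → ℝ} (hwr : ∑ i, w i ^ 2 ≤ r ^ 2)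
    (hw : ∀ j, δ + μ * ∑ i ∈ Finset.Ici j, w i ^ 2 ≤ M * w j) (B : BaseAlg FirstOrder) :
    ∃ P : Problem FirstOrder, P.dom = ⟨n, Metric.closedBall 0 r⟩ ∧ InClass μ 0 (6 * M) P ∧
      IsLip (3 * M) P ∧ ∀ t : Fin T,
        δ + μ / 2 * ∑ i ∈ Finset.Ici t, w i ^ 2 ≤ P.f (B.query P t) - P.minVal := by
  obtain ⟨u, hu, horth⟩ := (revealsInOrder_regMax_slope M μ w).exists_orthonormal
    (by rwa [finrank_euclideanSpace_fin]) (B ⟨n, Metric.closedBall 0 r⟩)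
  have hM : 0 ≤ M := (mul_nonneg hμ hr).trans hμr
  have hsub := isStrongSubgradient_regMax μ (slope M μ w u)
  have hgrad : ∀ x ∈ Metric.closedBall 0 r, ‖regMaxGrad μ (slope M μ w u) x‖ ≤ 3 * M := by
    intro x hx
    have hslope : ∀ j, ‖slope M μ w u j‖ ≤ M + μ * r := fun j =>
      norm_slope_le hu hμ hM hr <| hwr.trans' <|
        Finset.sum_le_univ_sum_of_nonneg fun i => sq_nonneg (w i)
    calc ‖regMaxGrad μ (slope M μ w u) x‖ ≤ μ * r + (M + μ * r) := by
          refine norm_add_le_of_le ?_ (hslope _)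
          rw [norm_smul, Real.norm_of_nonneg hμ]
          gcongr
          exact mem_closedBall_zero_iff.1 hx
      _ ≤ 3 * M := by linarith
  have hmin : -∑ i, w i • u i ∈ Metric.closedBall 0 r := by
    rw [mem_closedBall_zero_iff, norm_neg, ← pow_le_pow_iff_left₀ (norm_nonneg _) hr two_ne_zero,
      norm_sum_smul_sq hu]
    exact hwr
  set P := ballProblem hr (hsub.convexOn hμ) (regMaxGrad μ (slope M μ w u))
  refine ⟨P, rfl, ?_, ballProblem_isLip hr hμ hsub hgrad, fun t => ?_⟩
  · convert ballProblem_inClass hr hμ hsub hgrad using 1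
    ring
  · have hquery : ∀ i, t ≤ i → ⟪u i, B.query P t⟫ = 0 := fun i hi => by
      rw [BaseAlg.query, B.history_eq_transcript]
      exact horth t i hi
    exact (le_regMax_slope_sub_regMax_slope hu hμ hw hquery).trans
      (sub_le_sub_left (P.minVal_le hmin) _)

theorem sum_fin_Ici_eq_sum_Icc {β : Type*} [AddCommMonoid β] (a : ℕ → β) (j : Fin T) :
    ∑ i ∈ Finset.Ici j, a (i + 1) = ∑ s ∈ Finset.Icc (j + 1 : ℕ) T, a s := by
  rw [← Finset.Ico_add_one_right_eq_Icc, ← Finset.sum_Ico_add', ← Fin.map_valEmbedding_Ici,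
    Finset.sum_map]
  rfl

theorem isOracleLowerBound_of_weights {F : Set (Problem FirstOrder)} (hn : 2 * T ≤ n)
    (hμ : 0 ≤ μ) (hr : 0 ≤ r) (hμr : μ * r ≤ M) {w : ℕ → ℝ}
    (hwr : ∑ s ∈ Finset.Icc 1 T, w s ^ 2 ≤ r ^ 2)
    (hw : ∀ s ∈ Finset.Icc 1 T, δ + μ * ∑ i ∈ Finset.Icc s T, w i ^ 2 ≤ M * w s)
    (hF : ∀ P : Problem FirstOrder, P.dom = ⟨n, Metric.closedBall 0 r⟩ → InClass μ 0 (6 * M) P →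
      IsLip (3 * M) P → P ∈ F) (hT : 0 < T) :
    IsOracleLowerBound F (fun _ s => δ + μ / 2 * ∑ i ∈ Finset.Icc s T, w i ^ 2) T := by
  intro B _
  have : NeZero T := ⟨hT.ne'⟩
  obtain ⟨P, hdom, hclass, hlip, hgap⟩ := exists_resisting_problem (w := fun i : Fin T => w (i + 1))
    hn hμ hr hμr
    (by rwa [Fin.sum_univ_eq_sum_range fun i => w (i + 1) ^ 2,
      ← sum_Icc_one_eq_sum_range fun s => w s ^ 2])
    (fun j => by
      rw [sum_fin_Ici_eq_sum_Icc fun s => w s ^ 2]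
      exact hw _ (Finset.mem_Icc.2 ⟨Nat.le_add_left _ _, j.2⟩)) B
  refine ⟨P, hF P hdom hclass hlip, fun t ht => ?_⟩
  simpa only [sum_fin_Ici_eq_sum_Icc fun s => w s ^ 2] using hgap ⟨t, ht⟩

theorem isOracleLowerBound_lipschitzClass {R : ℝ} (hM : 0 ≤ M) (hR : 0 ≤ R) (hT : 0 < T)
    (hn : 2 * T ≤ n) :
    IsOracleLowerBound (lipschitzClass n M R) (fun _ _ => 1 / 12 * (M * R / √T)) T := by
  have h := isOracleLowerBound_of_weights (μ := 0) (M := M / 6) (r := R / 2)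
    (δ := M / 6 * (R / 2 / √T)) (w := fun _ => R / 2 / √T) (F := lipschitzClass n M R) hn le_rfl
    (by positivity) ((zero_mul _).trans_le (by positivity))
    (by
      have : (T : ℝ) ≠ 0 := Nat.cast_ne_zero.2 hT.ne'
      rw [Finset.sum_const, Nat.card_Icc, Nat.add_sub_cancel, nsmul_eq_mul, div_pow _ √(T : ℝ),
        Real.sq_sqrt (Nat.cast_nonneg T), mul_div_cancel₀ _ this])
    (fun s _ => by simp only [zero_mul, add_zero, le_refl])
    (fun P hdom hclass hlip => ⟨congrArg Domain.dim hdom,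
      hasDiam_of_dom_eq (by lia) hR hdom, by rwa [mul_div_cancel₀ M (by norm_num)] at hclass,
      hlip.mono (by linarith)⟩) hT
  convert h using 3
  ring

theorem regretAtLeast_lipschitzClass {R : ℝ} (hM : 0 ≤ M) (hR : 0 ≤ R) (hT : 0 < T)
    (hn : 2 * T ≤ n) (hK : 0 < K) :
    RegretAtLeast (lipschitzClass n M R) K T (1 / 12 * (M * R * √T)) := by
  have h := (isOracleLowerBound_lipschitzClass hM hR hT hn).regretAtLeast_sum
    (fun _ _ _ _ => le_rfl) hK
  rwa [Finset.sum_const, Nat.card_Icc, Nat.add_sub_cancel, nsmul_eq_mul, mul_left_comm,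
    mul_div_left_comm, Real.div_sqrt] at h

theorem sum_Icc_inv_sq_le {s : ℕ} (hs : 0 < s) (T : ℕ) :
    ∑ i ∈ Finset.Icc s T, ((i : ℝ) ^ 2)⁻¹ ≤ 2 / s := by
  obtain ⟨k, rfl⟩ := Nat.exists_eq_add_of_le' hs
  have h := sum_Ioo_inv_sq_le (α := ℝ) k (T + 1)
  rwa [← Finset.Ico_add_one_left_eq_Ioo, Finset.Ico_add_one_right_eq_Icc, ← Nat.cast_add_one] at h

theorem sum_sum_Icc_eq_sum_mul (a : ℕ → ℝ) (T : ℕ) :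
    ∑ s ∈ Finset.Icc 1 T, ∑ i ∈ Finset.Icc s T, a i = ∑ i ∈ Finset.Icc 1 T, i * a i := by
  rw [Finset.sum_comm' (t' := Finset.Icc 1 T) (s' := fun i => Finset.Icc 1 i)]
  · simp only [Finset.sum_const, Nat.card_Icc, Nat.add_sub_cancel, nsmul_eq_mul]
  · intro s i
    simp only [Finset.mem_Icc]
    lia

theorem isOracleLowerBound_strongLipschitzClass (hμ : 0 < μ) (hM : 0 ≤ M) (hT : 0 < T)
    (hn : 2 * T ≤ n) :
    IsOracleLowerBound (strongLipschitzClass n μ M)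
      (fun _ s => 1 / 288 * (M ^ 2 / μ * ∑ i ∈ Finset.Icc s T, ((i : ℝ) ^ 2)⁻¹)) T := by
  have hsum (s : ℕ) : ∑ i ∈ Finset.Icc s T, (M / 6 / (2 * μ * i)) ^ 2 =
      M ^ 2 / (144 * μ ^ 2) * ∑ i ∈ Finset.Icc s T, ((i : ℝ) ^ 2)⁻¹ := by
    rw [Finset.mul_sum]
    refine Finset.sum_congr rfl fun i _ => ?_
    ring
  have hsum_le {s : ℕ} (hs : 0 < s) :
      ∑ i ∈ Finset.Icc s T, (M / 6 / (2 * μ * i)) ^ 2 ≤ M ^ 2 / (144 * μ ^ 2) * (2 / s) := by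
    rw [hsum]
    gcongr
    exact sum_Icc_inv_sq_le hs T
  have h := isOracleLowerBound_of_weights (μ := μ) (M := M / 6) (r := M / 6 / μ)
    (δ := 0) (w := fun s => M / 6 / (2 * μ * s)) (F := strongLipschitzClass n μ M) hn hμ.le
    (by positivity) (mul_div_cancel₀ _ hμ.ne').le
    ((hsum_le one_pos).trans <| by
      rw [Nat.cast_one]
      field_simp
      linarith [sq_nonneg M])
    (fun s hs => by
      have hs : 0 < s := (Finset.mem_Icc.1 hs).1
      calc 0 + μ * ∑ i ∈ Finset.Icc s T, (M / 6 / (2 * μ * i)) ^ 2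
          ≤ μ * (M ^ 2 / (144 * μ ^ 2) * (2 / s)) := by
            rw [zero_add]
            gcongr
            exact hsum_le hs
        _ = M / 6 * (M / 6 / (2 * μ * s)) := by
            field_simp
            ring)
    (fun P hdom hclass hlip => ⟨congrArg Domain.dim hdom,
      by rwa [mul_div_cancel₀ M (by norm_num)] at hclass, hlip.mono (by linarith)⟩) hT
  convert h using 3
  rw [hsum]
  field_simp
  ring

theorem regretAtLeast_strongLipschitzClass (hμ : 0 < μ) (hM : 0 ≤ M) (hT : 0 < T)
    (hn : 2 * T ≤ n) (hK : 0 < K) :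
    RegretAtLeast (strongLipschitzClass n μ M) K T (1 / 288 * (M ^ 2 / μ * Real.log T)) := by
  refine ((isOracleLowerBound_strongLipschitzClass hμ hM hT hn).regretAtLeast_sum
    (fun _ _ _ _ => le_rfl) hK).mono ?_
  rw [← Finset.mul_sum, ← Finset.mul_sum, sum_sum_Icc_eq_sum_mul]
  gcongr
  refine (log_le_sum_inv T).trans_eq (Finset.sum_congr rfl fun i hi => ?_)
  have : (i : ℝ) ≠ 0 := Nat.cast_ne_zero.2 (Nat.ne_of_gt (Finset.mem_Icc.1 hi).1)
  field_simp

end Nonsmooth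

end FMAB

theorem mainTheorem3 :
    -- the general lower bound
    (∀ (Ω : ℕ → Type*) (F : Set (FMAB.Problem Ω)) (g : FMAB.Problem Ω → ℕ → ℝ) (T K : ℕ),
      0 < K → FMAB.IsOracleLowerBound F g T →
      (∀ s ∈ Finset.Icc 1 T, BddBelow ((fun P => g P s) '' F)) →
      FMAB.RegretAtLeast F K T
        (⨅ k : {k : Fin K → ℕ // ∑ i, k i = T}, ∑ i, FMAB.cumHardness F g (k.1 i))) ∧
    -- the orders that follow from the four rates of the hardness
    (∀ (Ω : ℕ → Type*) (F : Set (FMAB.Problem Ω)) (g : FMAB.Problem Ω → ℕ → ℝ) (T K : ℕ),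
      0 < T → 0 < K → FMAB.IsOracleLowerBound F g T →
      ∀ c : ℝ, 0 < c →
        (∀ M R : ℝ, 0 < M → 0 < R →
          (∀ s ∈ Finset.Icc 1 T, c * (M * R / √(s : ℝ)) ≤ FMAB.hardness F g s) →
          (∀ m ∈ Finset.Icc 1 T, c * (M * R * √(m : ℝ)) ≤ FMAB.cumHardness F g m) ∧
          FMAB.RegretAtLeast F K T (c * (M * R * √(T : ℝ)))) ∧
        (∀ L R : ℝ, 0 < L → 0 < R →
          (∀ s ∈ Finset.Icc 1 T, c * (L * R ^ 2 / (s : ℝ) ^ 2) ≤ FMAB.hardness F g s) →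
          (∀ m ∈ Finset.Icc 1 T, c * (L * R ^ 2) ≤ FMAB.cumHardness F g m) ∧
          FMAB.RegretAtLeast F K T (c * (L * R ^ 2))) ∧
        (∀ μ M : ℝ, 0 < μ → 0 < M →
          (∀ s ∈ Finset.Icc 1 T, c * (M ^ 2 / (μ * (s : ℝ))) ≤ FMAB.hardness F g s) →
          (∀ m ∈ Finset.Icc 1 T,
            c * (M ^ 2 / μ * Real.log (m : ℝ)) ≤ FMAB.cumHardness F g m) ∧
          FMAB.RegretAtLeast F K T (c * (M ^ 2 / μ * Real.log (T : ℝ)))) ∧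
        (∀ μ L R : ℝ, 0 < μ → μ ≤ L → 0 < R →
          (∀ s ∈ Finset.Icc 1 T,
            c * (R ^ 2 * Real.exp (-(s : ℝ) / √(L / μ))) ≤ FMAB.hardness F g s) →
          (∀ m ∈ Finset.Icc 1 T, c * Real.exp (-1) * R ^ 2 ≤ FMAB.cumHardness F g m) ∧
          FMAB.RegretAtLeast F K T (c * Real.exp (-1) * R ^ 2))) ∧
    -- the four standard classes with a first-order oracle
    (∃ c : ℝ, 0 < c ∧
      (∀ (M R : ℝ) (T n K : ℕ), 0 < M → 0 < R → 0 < T → 2 * T ≤ n → 0 < K →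
        FMAB.RegretAtLeast (FMAB.lipschitzClass n M R) K T (c * (M * R * √(T : ℝ)))) ∧
      (∀ (L R : ℝ) (T n K : ℕ), 0 < L → 0 < R → 0 < T → 0 < n → 0 < K →
        FMAB.RegretAtLeast (FMAB.smoothClass n L R) K T (c * (L * R ^ 2))) ∧
      (∀ (μ M : ℝ) (T n K : ℕ), 0 < μ → 0 < M → 0 < T → 2 * T ≤ n → 0 < K →
        FMAB.RegretAtLeast (FMAB.strongLipschitzClass n μ M) K T
          (c * (M ^ 2 / μ * Real.log (T : ℝ)))) ∧
      (∀ (μ L R : ℝ) (T n K : ℕ), 0 < μ → μ ≤ L → 0 < R → 0 < T → 0 < n → 0 < K →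
        FMAB.RegretAtLeast (FMAB.strongSmoothClass n μ L R) K T (c * (L * R ^ 2)))) := by
  refine ⟨fun Ω F g T K hK hg hb => ?_, fun Ω F g T K hT hK hg c hc =>
    ⟨fun M R hM hR hh => ?_, fun L R hL hR hh => ?_, fun μ M hμ hM hh => ?_,
      fun μ L R hμ hμL hR hh => ?_⟩,
    1 / 288, by norm_num, fun M R T n K hM hR hT hn hK => ?_, fun L R T n K hL hR hT hn hK => ?_,
    fun μ M T n K hμ hM => FMAB.regretAtLeast_strongLipschitzClass hμ hM.le,
    fun μ L R T n K hμ hμL hR hT hn hK => ?_⟩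
  · exact (hg.regretAtLeast_cumHardness hb hK).mono
      (FMAB.iInf_sum_le_of_zero Finset.sum_empty hK T)
  · simp only [mul_div_assoc', ← mul_assoc] at hh ⊢
    exact hg.rate_of_div_sqrt_le_hardness hT hK (by positivity) hh
  · refine hg.rate_of_first_le_hardness hT hK (by simp) (fun s hs => ?_) hh
    have : (0 : ℝ) < s := Nat.cast_pos.2 (Finset.mem_Icc.1 hs).1
    positivity
  · simp only [← mul_assoc, ← div_div, mul_div_assoc'] at hh ⊢
    exact hg.rate_of_div_le_hardness hT hK (by positivity) hh
  · simp only [mul_right_comm, ← mul_assoc] at hh ⊢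
    exact hg.rate_of_exp_le_hardness hT hK (by positivity) ((one_le_div hμ).2 hμL) hh
  · exact (FMAB.regretAtLeast_lipschitzClass hM.le hR.le hT hn hK).mono (by gcongr; norm_num)
  · exact (FMAB.regretAtLeast_strongSmoothClass hn hR.le hL.le hL.le hT hK).mono
      (by gcongr; norm_num)
  · have hL : 0 ≤ L := hμ.le.trans hμL
    exact (FMAB.regretAtLeast_strongSmoothClass hn hR.le hL hμL hT hK).mono (by gcongr; norm_num)
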